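/- **Setting.** Let $G$ be a finite simple graph with vertex set $V$, and for each $v\in V$ let $d_v\ge 1$ be an integer; for $A\subseteq V$ put $d_A=\prod_{v\in A}d_v$ and $\mathcal R_A=\prod_{v\in A}[d_v]$, and let $\mathcal R=\mathcal R_V$. For a finite set $I$ let $\Delta_I\subset\mathbb R^I$ be the open probability simplex (strictly positive coordinates summing to $1$). The *graphical model* $\mathcal M_G$ is the set of all $p\in\Delta_{\mathcal R}$ for which there are complex parameters $\theta^{(K)}_{i_K}$ ($K$ a maximal clique of $G$, $i_K\in\mathcal R_K$) with $p_i=\prod_K\theta^{(K)}_{i_K}$ for all $i\in\mathcal R$. For positive integers $n_1,\dots,n_k$, the *independence model* on $k$ random variables with $n_1,\dots,n_k$ states is the set of all $p\in\Delta_{[n_1]\times\cdots\times[n_k]}$ of the form $p_{i_1\cdots i_k}=q^1_{i_1}\cdots q^k_{i_k}$ with $q^l\in\Delta_{[n_l]}$. For a model $\mathcal M\subseteq\Delta_I$ and $r\ge1$, $$\mathrm{Mixt}^r(\mathcal M)=\Big\{\sum_{j=1}^r\pi_jp^j:\ \pi\in\Delta_{[r]},\ p^1,\dots,p^r\in\mathcal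 M\Big\}.$$ Let $\mathcal M\subseteq\Delta_I$ be a model whose Zariski closure $X\subseteq\mathbb C^I$ is irreducible. For $u\in\mathbb C^I$, a *critical point* of $\ell_u(p)=\sum_i u_i\log p_i$ on $X$ is a nonsingular point $p$ of $X$, with all coordinates nonzero, such that $\sum_i (u_i/p_i)v_i=0$ for all $v$ in the tangent space $T_pX$. A natural number $N$ is the *ML degree* $\mathrm{MLdeg}(\mathcal M)$ if there is a nonzero polynomial $F$ on $\mathbb C^I$ such that $\ell_u$ has exactly $N$ critical points on $X$ for all $u$ with $F(u)\neq0$. The graph $G$ is a *clique star* with center $S\subseteq V$ and leaves $C_1,\dots,C_k\subseteq V\setminus S$ if $C_1\cup S,\dots,C_k\cup S$ are the maximal cliques of $G$, listed without repetition, and $(C_l\cup S)\cap(C_m\cup S)=S$ for all $l\ne m$. **Theorem.** Let $G$ be a clique star with center $S$ and leaves $C_1,\dots,C_k$, let $r\ge1$, and let $\mathcal M_{C_1\perp\cdots\perp C_k}$ be the independence model on $k$ random variables with $d_{C_1},\dots,d_{C_k}$ states. Then $$\mathrm{MLdeg}\big(\mathrm{Mixt}^r(\mathcal M_G)\big)=\Big(\mathrm{MLdeg}\big(\mathrm{Mixt}^r(\mathcal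 M_{C_1\perp\cdots\perp C_k})\big)\Big)^{d_S};$$ that is, a natural number $m$ is the ML degree of $\mathrm{Mixt}^r(\mathcal M_G)$ if and only if $m=N^{d_S}$, where $N$ is the ML degree of $\mathrm{Mixt}^r(\mathcal M_{C_1\perp\cdots\perp C_k})$. -/

import Mathlib

open scoped BigOperators

noncomputable section

/-- The open probability simplex in `ℝ^I`. -/
def openSimplex (I : Type*) [Fintype I] : Set (I → ℝ) :=
  {p | (∀ i, 0 < p i) ∧ ∑ i, p i = 1}

/-- The `r`-th mixture model of a discrete statistical model `M ⊆ openSimplex I`. -/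
def mixture {I : Type*} (r : ℕ) (M : Set (I → ℝ)) : Set (I → ℝ) :=
  {p | ∃ w ∈ openSimplex (Fin r), ∃ q : Fin r → I → ℝ,
    (∀ j, q j ∈ M) ∧ ∀ i, p i = ∑ j, w j * q j i}

/-! ### Graphical models and independence models -/

open Classical in
/-- The finite set of containment-maximal cliques of a graph. -/
def maximalCliques {V : Type*} [Fintype V] (G : SimpleGraph V) : Finset (Finset V) :=
  Finset.univ.filter fun K => Maximal (fun T : Finset V => G.IsClique (T : Set V)) K

/-- The monomial parametrization of the graphical model: the coordinate indexed by the joint state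
`i` is the product over the maximal cliques `K` of the parameter `θ K i_K`, where `i_K` is
the restriction of `i` to `K`.  (The values `θ K` for other sets `K` are not used.) -/
def graphicalParam {V : Type*} [Fintype V] (G : SimpleGraph V) (d : V → ℕ)
    (θ : (K : Finset V) → ((v : K) → Fin (d v)) → ℂ) (i : (v : V) → Fin (d v)) : ℂ :=
  ∏ K ∈ maximalCliques G, θ K (fun v => i v)

/-- The discrete graphical model of `G`, where the variable at the node `v` has `d v` states:
the part of the image of the complex monomial map that lies in the open probability simplex. -/
def graphicalModel {V : Type*} [Fintype V] [DecidableEq V] (G : SimpleGraph V) (d : V → ℕ) :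
    Set (((v : V) → Fin (d v)) → ℝ) :=
  {p | p ∈ openSimplex ((v : V) → Fin (d v)) ∧
    ∃ θ, ∀ i, (p i : ℂ) = graphicalParam G d θ i}

/-- The model of `k` mutually independent random variables with `n 0, …, n (k-1)` states:
all positive joint distributions that are products of distributions of the variables. -/
def independenceModel {k : ℕ} (n : Fin k → ℕ) : Set (((l : Fin k) → Fin (n l)) → ℝ) :=
  {p | p ∈ openSimplex ((l : Fin k) → Fin (n l)) ∧
    ∃ q : (l : Fin k) → Fin (n l) → ℝ,
      (∀ l, q l ∈ openSimplex (Fin (n l))) ∧ ∀ i, p i = ∏ l, q l (i l)}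

/-- `G` is a clique star with center `S` and leaves `C 0, …, C (k-1)`: the sets `C l ∪ S` are the
maximal cliques of `G`, listed without repetition, any two of them meet exactly in `S`, and
`C l` is the complement of `S` in `C l ∪ S`. -/
structure IsCliqueStar {V : Type*} [Fintype V] [DecidableEq V] (G : SimpleGraph V) {k : ℕ}
    (C : Fin k → Finset V) (S : Finset V) : Prop where
  mem_maximalCliques_iff : ∀ K : Finset V, K ∈ maximalCliques G ↔ ∃ l, C l ∪ S = K
  injective : Function.Injective fun l => C l ∪ S
  inter_eq : ∀ l m, l ≠ m → (C l ∪ S) ∩ (C m ∪ S) = S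
  disjoint : ∀ l, Disjoint (C l) S

/-! ### Maximum likelihood degree -/

/-- The Zariski closure in complex affine space of a set of real points. -/
def zariskiClosure {I : Type*} (M : Set (I → ℝ)) : Set (I → ℂ) :=
  MvPolynomial.zeroLocus ℂ
    (MvPolynomial.vanishingIdeal ℂ ((fun (p : I → ℝ) (i : I) => (p i : ℂ)) '' M))

/-- The Zariski tangent space at `z` of the affine variety `X`. -/
def zariskiTangentSpace {I : Type*} [Fintype I] (X : Set (I → ℂ)) (z : I → ℂ) :
    Submodule ℂ (I → ℂ) where
  carrier := {v | ∀ f ∈ MvPolynomial.vanishingIdeal ℂ X,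
    ∑ i, MvPolynomial.eval z (MvPolynomial.pderiv i f) * v i = 0}
  add_mem' := by
    intro a b ha hb f hf
    simp only [Pi.add_apply, mul_add, Finset.sum_add_distrib, ha f hf, hb f hf, add_zero]
  zero_mem' := by
    intro f _
    simp
  smul_mem' := by
    intro c a ha f hf
    have h := ha f hf
    simp only [Pi.smul_apply, smul_eq_mul, mul_left_comm _ c, ← Finset.mul_sum, h, mul_zero]

/-- The nonsingular points of an irreducible affine variety `X`: the points at which the Zariski
tangent space has the least dimension (this least dimension is the dimension of `X`). -/
def regularPoints {I : Type*} [Fintype I] (X : Set (I → ℂ)) : Set (I → ℂ) :=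
  {z | z ∈ X ∧ ∀ w ∈ X, Module.finrank ℂ (zariskiTangentSpace X z) ≤
    Module.finrank ℂ (zariskiTangentSpace X w)}

/-- The complex critical points on `X` of the log-likelihood function
`ℓ_u(p) = ∑ i, u i * log (p i)`: the nonsingular points of `X` without zero coordinates at which
the differential `∑ i, (u i / p i) dp_i` of `ℓ_u` vanishes on the tangent space of `X`. -/
def criticalPoints {I : Type*} [Fintype I] (X : Set (I → ℂ)) (u : I → ℂ) : Set (I → ℂ) :=
  {p | p ∈ regularPoints X ∧ (∀ i, p i ≠ 0) ∧
    ∀ v ∈ zariskiTangentSpace X p, ∑ i, u i / p i * v i = 0}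

/-- `N` is the ML degree of the model `M`: for generic data `u`, that is, for all `u` outside some
proper algebraic hypersurface, the log-likelihood function `ℓ_u` has exactly `N` complex critical
points on the Zariski closure of `M`. -/
def IsMLDegree {I : Type*} [Fintype I] (M : Set (I → ℝ)) (N : ℕ) : Prop :=
  ∃ F : MvPolynomial I ℂ, F ≠ 0 ∧ ∀ u : I → ℂ, MvPolynomial.eval u F ≠ 0 →
    (criticalPoints (zariskiClosure M) u).encard = N

/-- The ML degree of a model is unique. -/
theorem IsMLDegree.unique {I : Type*} [Fintype I] {M : Set (I → ℝ)} {N N' : ℕ}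
    (h : IsMLDegree M N) (h' : IsMLDegree M N') : N = N' := by
  obtain ⟨F, hF, h⟩ := h
  obtain ⟨F', hF', h'⟩ := h'
  have hne : F * F' ≠ 0 := mul_ne_zero hF hF'
  obtain ⟨u, hu⟩ : ∃ u, MvPolynomial.eval u (F * F') ≠ 0 := by
    by_contra hcon
    push Not at hcon
    exact hne (MvPolynomial.funext fun u => by rw [hcon u, map_zero])
  rw [map_mul] at hu
  have h1 := h u (left_ne_zero_of_mul hu)
  rw [h' u (right_ne_zero_of_mul hu)] at h1
  exact_mod_cast h1.symm

end

/-! ### Points over algebras and tangent vectors -/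

section Points

open MvPolynomial

variable {I J T : Type*}

/-! Given the state `s` of the center, the leaves of a clique star are independent, and the
distribution of `s` is unrestricted. So the graphical model is a `fiberedModel` over the center
states: points `l s * x s t` with arbitrary positive marginal `l` and every conditional `x s` in the
independence model (`IsCliqueStar.graphicalModel_eq`). By Bayes' rule, mixing preserves this shape
(`mixture_fiberedModel`).

On a fibered model the log-likelihood splits into a term in `l`, with coefficients the fiber sums of
`u`, plus one log-likelihood per fiber. The first has a single critical point, the normalized fiber
sums. The others are independent problems on the closure of `M`. Hence critical points are counted
by a product over the center states (`encard_criticalPoints_fiberedModel`). The work lies in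
checking that Zariski closures, tangent spaces and nonsingular points decompose in the same way.

For generic data all factors equal the ML degree of the fiber, which gives the power. That the fiber
has an ML degree whenever the fibered model has one is `exists_generic_value`. -/

theorem eval_aeval_eq (g : I → MvPolynomial J ℂ) (f : MvPolynomial I ℂ) (x : J → ℂ) :
    eval x (aeval g f) = eval (fun i => eval x (g i)) f := by
  have := comp_aeval_apply (B := ℂ) (φ := aeval (R := ℂ) x) g f
  simpa [aeval_eq_eval] using this

theorem aeval_aeval_eq {A : Type*} [CommRing A] [Algebra ℂ A] (g : I → MvPolynomial J ℂ)
    (f : MvPolynomial I ℂ) (x : J → A) :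
    aeval x (aeval g f) = aeval (fun i => aeval x (g i)) f :=
  comp_aeval_apply (φ := aeval (R := ℂ) x) g f

theorem mem_vanishingIdeal_zariskiClosure {M : Set (I → ℝ)} {f : MvPolynomial I ℂ} :
    f ∈ vanishingIdeal ℂ (zariskiClosure M) ↔ ∀ p ∈ M, eval (fun i => (p i : ℂ)) f = 0 := by
  have : vanishingIdeal ℂ (zariskiClosure M) =
      vanishingIdeal ℂ ((fun (p : I → ℝ) (i : I) => (p i : ℂ)) '' M) :=
    zeroLocus_vanishingIdeal_galoisConnection.u_l_u_eq_u _
  rw [this]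
  simp [mem_vanishingIdeal_iff, aeval_eq_eval]

theorem mem_zariskiClosure {M : Set (I → ℝ)} {z : I → ℂ} :
    z ∈ zariskiClosure M ↔
      ∀ f : MvPolynomial I ℂ, (∀ p ∈ M, eval (fun i => (p i : ℂ)) f = 0) → eval z f = 0 := by
  simp [zariskiClosure, mem_vanishingIdeal_iff, aeval_eq_eval]

theorem coe_mem_zariskiClosure {M : Set (I → ℝ)} {p : I → ℝ} (hp : p ∈ M) :
    (fun i => (p i : ℂ)) ∈ zariskiClosure M :=
  mem_zariskiClosure.2 fun _ hf => hf p hp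

/-- The first-order deformation of the point `z` in the direction `v`. -/
def dualPoint (z v : I → ℂ) (i : I) : DualNumber ℂ :=
  TrivSqZeroExt.inl (z i) + TrivSqZeroExt.inr (v i)

/-- First-order Taylor expansion. Tangent vectors thereby become points over the dual numbers, so
identities proved over all algebras apply to points and tangent vectors alike. -/
theorem aeval_dualPoint [Fintype I] (z v : I → ℂ) (f : MvPolynomial I ℂ) :
    aeval (dualPoint z v) f = TrivSqZeroExt.inl (eval z f) +
      TrivSqZeroExt.inr (∑ i, eval z (pderiv i f) * v i) := by
  classical
  induction f using MvPolynomial.induction_on with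
  | C a => simp [TrivSqZeroExt.algebraMap_eq_inl]
  | add p q hp hq =>
    rw [map_add, hp, hq]
    simp only [map_add, add_mul, Finset.sum_add_distrib, TrivSqZeroExt.inl_add,
      TrivSqZeroExt.inr_add]
    ring
  | mul_X p j hp =>
    rw [map_mul, hp, aeval_X, dualPoint]
    ext
    · simp
    · simp only [TrivSqZeroExt.snd_mul, TrivSqZeroExt.fst_add, TrivSqZeroExt.fst_inl,
        TrivSqZeroExt.fst_inr, TrivSqZeroExt.snd_add, TrivSqZeroExt.snd_inl, TrivSqZeroExt.snd_inr,
        add_zero, zero_add, smul_eq_mul, MulOpposite.smul_eq_mul_unop, MulOpposite.unop_op,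
        Derivation.leibniz, pderiv_X, map_add, map_mul, eval_X, add_mul, Finset.sum_add_distrib,
        Finset.sum_mul]
      have h : ∑ i, eval z p * eval z ((Pi.single i 1 : I → MvPolynomial I ℂ) j) * v i
          = eval z p * v j := by
        simp [Pi.single_apply, apply_ite (eval z)]
      rw [h]
      simp [mul_comm, mul_left_comm]

theorem mem_zariskiTangentSpace [Fintype I] {X : Set (I → ℂ)} {z v : I → ℂ} :
    v ∈ zariskiTangentSpace X z ↔
      ∀ f ∈ vanishingIdeal ℂ X, ∑ i, eval z (pderiv i f) * v i = 0 :=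
  Iff.rfl

theorem aeval_dualPoint_eq_zero [Fintype I] {X : Set (I → ℂ)} {z v : I → ℂ} (hz : z ∈ X)
    (hv : v ∈ zariskiTangentSpace X z) {f : MvPolynomial I ℂ} (hf : f ∈ vanishingIdeal ℂ X) :
    aeval (dualPoint z v) f = 0 := by
  have h : eval z f = 0 := hf z hz
  rw [aeval_dualPoint, mem_zariskiTangentSpace.1 hv f hf, h]
  simp

theorem mem_zariskiTangentSpace_of_aeval [Fintype I] {X : Set (I → ℂ)} {z v : I → ℂ}
    (h : ∀ f ∈ vanishingIdeal ℂ X, (aeval (dualPoint z v) f).snd = 0) :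
    v ∈ zariskiTangentSpace X z := by
  intro f hf
  have := h f hf
  rwa [aeval_dualPoint, TrivSqZeroExt.snd_add, TrivSqZeroExt.snd_inl, TrivSqZeroExt.snd_inr,
    zero_add] at this

/-- Homogenization with respect to the linear form `∑ t, x t`. -/
theorem exists_homogenization [Fintype T] (f : MvPolynomial T ℂ) :
    ∃ (g : MvPolynomial T ℂ) (N : ℕ), ∀ (A : Type) [CommRing A] [Algebra ℂ A] (x : T → A) (a : A),
      ∑ t, x t = 1 → aeval (fun t => a * x t) g = a ^ N * aeval x f := by
  induction f using MvPolynomial.induction_on with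
  | C c => exact ⟨C c, 0, fun A _ _ x a _ => by simp⟩
  | add p q hp hq =>
    obtain ⟨g, n, hg⟩ := hp
    obtain ⟨h, m, hh⟩ := hq
    -- At the point `a * x` the form `∑ t, X t` takes the value `a`, so its powers equalize the two
    -- degrees.
    refine ⟨(∑ t, X t) ^ m * g + (∑ t, X t) ^ n * h, n + m, fun A _ _ x a hx => ?_⟩
    simp only [map_add, map_mul, map_pow, map_sum, aeval_X, hg A x a hx, hh A x a hx,
      ← Finset.mul_sum, hx]
    ring
  | mul_X p t hp =>
    obtain ⟨g, n, hg⟩ := hp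
    refine ⟨g * X t, n + 1, fun A _ _ x a hx => ?_⟩
    simp only [map_mul, aeval_X, hg A x a hx]
    ring

/-- A polynomial that vanishes on the open simplex vanishes at all points with coordinate sum `1`
over all algebras. -/
theorem aeval_eq_zero_of_openSimplex [Fintype T] {f : MvPolynomial T ℂ}
    (hf : ∀ p ∈ openSimplex T, eval (fun i => (p i : ℂ)) f = 0)
    {A : Type} [CommRing A] [Algebra ℂ A] {x : T → A} (hx : ∑ t, x t = 1) : aeval x f = 0 := by
  cases isEmpty_or_nonempty T
  · have : Subsingleton A := subsingleton_of_zero_eq_one (by simpa using hx)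
    exact Subsingleton.elim _ _
  obtain ⟨g, N, hg⟩ := exists_homogenization f
  -- Every vector with positive coordinates is a scalar multiple of a simplex point, so `g` vanishes
  -- on the positive orthant, which is Zariski dense.
  have hg0 : g = 0 := by
    refine funext_set (fun _ => (fun a : ℝ => (a : ℂ)) '' Set.Ioi 0)
      (fun _ => (Set.Ioi_infinite 0).image Complex.ofReal_injective.injOn) fun y hy => ?_
    choose c hc hcy using fun t => hy t (Set.mem_univ t)
    have hs : 0 < ∑ t, c t := Finset.sum_pos (fun t _ => hc t) Finset.univ_nonempty
    have h1 : ∑ t, c t / ∑ t, c t = 1 := by rw [← Finset.sum_div, div_self hs.ne']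
    have := hg ℂ (fun t => ((c t / ∑ t, c t : ℝ) : ℂ)) ((∑ t, c t : ℝ) : ℂ) (by exact_mod_cast h1)
    have h0 := hf (fun t => c t / ∑ t, c t) ⟨fun t => div_pos (hc t) hs, h1⟩
    rw [aeval_eq_eval, aeval_eq_eval] at this
    rw [h0, mul_zero] at this
    rw [map_zero, ← this]
    congr 2
    funext t
    rw [← hcy t, ← Complex.ofReal_mul, mul_div_cancel₀ _ hs.ne']
  have := hg A x 1 hx
  simpa [hg0] using this.symm

end Points

/-! ### Semicontinuity of the dimension of the tangent space -/

section Semicontinuity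

open MvPolynomial

variable {I : Type*} [Fintype I]

/-- The pairing of polynomials in the vanishing ideal with directions, by derivatives at `z`. -/
noncomputable def gradientPairing (X : Set (I → ℂ)) (z : I → ℂ) (W : Submodule ℂ (I → ℂ)) :
    (vanishingIdeal ℂ X).restrictScalars ℂ →ₗ[ℂ] Module.Dual ℂ W where
  toFun f :=
    { toFun := fun v => ∑ i, eval z (pderiv i f.1) * v.1 i
      map_add' := fun v w => by simp [mul_add, Finset.sum_add_distrib]
      map_smul' := fun c v => by simp [Finset.mul_sum, mul_left_comm] }
  map_add' f g := by
    ext v; simp [add_mul, Finset.sum_add_distrib]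
  map_smul' c f := by
    ext v; simp [Finset.mul_sum, mul_assoc]

/-- Semicontinuity. On a complement `W` of the tangent space at `w`, gradients of equations realize
a dual basis. The determinant expressing this is a polynomial nonzero at `w`, hence nonzero at some
point of `M`, where the tangent space then meets `W` trivially. Nonsingularity can therefore be
tested against the real points of the model. -/
theorem exists_finrank_zariskiTangentSpace_le {M : Set (I → ℝ)} {w : I → ℂ}
    (hw : w ∈ zariskiClosure M) :
    ∃ p ∈ M, Module.finrank ℂ (zariskiTangentSpace (zariskiClosure M) fun i => (p i : ℂ)) ≤
      Module.finrank ℂ (zariskiTangentSpace (zariskiClosure M) w) := by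
  classical
  set X := zariskiClosure M with hX
  obtain ⟨W, hW⟩ := Submodule.exists_isCompl (zariskiTangentSpace X w)
  have hsurj : Function.Surjective (gradientPairing X w W) := by
    rw [← LinearMap.range_eq_top, ← Subspace.dualCoannihilator_dualAnnihilator_eq
      (W := LinearMap.range (gradientPairing X w W))]
    have : (LinearMap.range (gradientPairing X w W)).dualCoannihilator = ⊥ := by
      rw [eq_bot_iff]
      intro v hv
      rw [Submodule.mem_dualCoannihilator] at hv
      have h1 : v.1 ∈ zariskiTangentSpace X w := fun f hf => hv _ ⟨⟨f, hf⟩, rfl⟩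
      have : v.1 ∈ (⊥ : Submodule ℂ (I → ℂ)) := by
        rw [← hW.inf_eq_bot]; exact ⟨h1, v.2⟩
      simpa using this
    rw [this, Submodule.dualAnnihilator_bot]
  let b := Module.finBasis ℂ W
  choose f hf using fun j => hsurj (b.coord j)
  let P : Matrix (Fin (Module.finrank ℂ W)) (Fin (Module.finrank ℂ W)) (MvPolynomial I ℂ) :=
    fun j i => ∑ t, pderiv t (f j).1 * C ((b i).1 t)
  have hP : ∀ z j i, eval z (P j i) = gradientPairing X z W (f j) (b i) := fun z j i => by
    simp [P, gradientPairing]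
  have hdet : eval w P.det ≠ 0 := by
    rw [RingHom.map_det]
    have : (eval w).mapMatrix P = 1 := by
      ext j i
      rw [RingHom.mapMatrix_apply, Matrix.map_apply, hP, hf, Matrix.one_apply, Module.Basis.coord_apply,
        Module.Basis.repr_self, Finsupp.single_apply]
      simp [eq_comm]
    rw [this, Matrix.det_one]
    exact one_ne_zero
  obtain ⟨p, hp, hpdet⟩ : ∃ p ∈ M, eval (fun i => (p i : ℂ)) P.det ≠ 0 := by
    by_contra! hcon
    exact hdet (mem_zariskiClosure.1 hw _ hcon)
  refine ⟨p, hp, ?_⟩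
  set z : I → ℂ := fun i => (p i : ℂ)
  have hdisj : Disjoint (zariskiTangentSpace X z) W := by
    rw [Submodule.disjoint_def]
    intro v hv hvW
    have hmul : ((eval z).mapMatrix P).mulVec (b.repr ⟨v, hvW⟩) = 0 := by
      ext j
      have h0 : gradientPairing X z W (f j) ⟨v, hvW⟩ = 0 := hv _ (f j).2
      rw [← b.sum_repr ⟨v, hvW⟩, _root_.map_sum] at h0
      rw [Pi.zero_apply, ← h0, Matrix.mulVec, dotProduct]
      refine Finset.sum_congr rfl fun i _ => ?_
      rw [RingHom.mapMatrix_apply, Matrix.map_apply, hP, map_smul, smul_eq_mul, mul_comm]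
    rw [RingHom.map_det] at hpdet
    have h := Matrix.eq_zero_of_mulVec_eq_zero hpdet hmul
    have : b.repr ⟨v, hvW⟩ = 0 := by ext i; simpa using congrFun h i
    simpa using this
  have h1 := Submodule.finrank_add_finrank_le_of_disjoint hdisj
  have h2 := Submodule.finrank_add_eq_of_isCompl hW
  omega

end Semicontinuity

/-! ### Fibered models -/

/-- The joint distributions on `I ≃ B × T` with arbitrary positive marginal distribution on `B`,
all of whose conditional distributions on `T` belong to `M`. -/
def fiberedModel {I B T : Type*} [Fintype B] (e : I ≃ B × T) (M : Set (T → ℝ)) : Set (I → ℝ) :=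
  {p | ∃ l ∈ openSimplex B, ∃ q : B → T → ℝ, (∀ s, q s ∈ M) ∧
    ∀ i, p i = l (e i).1 * q (e i).1 (e i).2}

/-- The point with marginal `l` and conditionals `x`. -/
def fiberedPoint {I B T A : Type*} [Mul A] (e : I ≃ B × T) (l : B → A) (x : B → T → A) (i : I) : A :=
  l (e i).1 * x (e i).1 (e i).2

section Fibered

open MvPolynomial

variable {I B T : Type*} {e : I ≃ B × T} {M : Set (T → ℝ)}

theorem sum_equiv_prod {A : Type*} [AddCommMonoid A] [Fintype I] [Fintype B] [Fintype T]
    (e : I ≃ B × T) (f : I → A) : ∑ i, f i = ∑ s, ∑ t, f (e.symm (s, t)) := by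
  rw [← e.symm.sum_comp, Fintype.sum_prod_type]

@[simp]
theorem fiberedPoint_symm {A : Type*} [Mul A] (e : I ≃ B × T) (l : B → A) (x : B → T → A)
    (s : B) (t : T) : fiberedPoint e l x (e.symm (s, t)) = l s * x s t := by
  simp [fiberedPoint]

theorem eq_of_symm {A : Type*} {f g : I → A} (e : I ≃ B × T)
    (h : ∀ s t, f (e.symm (s, t)) = g (e.symm (s, t))) : f = g := by
  funext i
  simpa using h (e i).1 (e i).2

theorem sum_eq_one_of_mem_zariskiClosure [Fintype T] (hM : M ⊆ openSimplex T) {x : T → ℂ}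
    (hx : x ∈ zariskiClosure M) : ∑ t, x t = 1 := by
  have := mem_zariskiClosure.1 hx (∑ t, X t - 1) fun p hp => by
    have h := (hM hp).2
    simp only [map_sub, map_sum, eval_X, map_one]
    rw [sub_eq_zero]
    exact_mod_cast h
  simpa [sub_eq_zero] using this

theorem sum_eq_zero_of_mem_zariskiTangentSpace [Fintype T] (hM : M ⊆ openSimplex T) {x w : T → ℂ}
    (hw : w ∈ zariskiTangentSpace (zariskiClosure M) x) : ∑ t, w t = 0 := by
  classical
  have hf : (∑ t, X t - 1 : MvPolynomial T ℂ) ∈ vanishingIdeal ℂ (zariskiClosure M) := by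
    rw [mem_vanishingIdeal_zariskiClosure]
    intro p hp
    have h := (hM hp).2
    simp only [map_sub, map_sum, eval_X, map_one]
    rw [sub_eq_zero]
    exact_mod_cast h
  have := hw _ hf
  simpa [pderiv_X, Pi.single_apply, apply_ite (eval x)] using this

theorem fiberedModel_subset_openSimplex [Fintype I] [Fintype B] [Fintype T] (hM : M ⊆ openSimplex T) :
    fiberedModel e M ⊆ openSimplex I := by
  rintro p ⟨l, hl, q, hq, hp⟩
  refine ⟨fun i => ?_, ?_⟩
  · rw [hp]; exact mul_pos (hl.1 _) ((hM (hq _)).1 _)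
  · rw [sum_equiv_prod e]
    simp only [hp, Equiv.apply_symm_apply, ← Finset.mul_sum, (hM (hq _)).2, mul_one, hl.2]

/-- Polynomials vanishing on the fibered model vanish at fibered points whose marginal is a point
of the simplex over an arbitrary algebra. -/
theorem aeval_fiberedPoint_eq_zero [Fintype B] {f : MvPolynomial I ℂ}
    (hf : f ∈ vanishingIdeal ℂ (zariskiClosure (fiberedModel e M))) {x : B → T → ℂ}
    (hx : ∀ s, x s ∈ zariskiClosure M) {A : Type} [CommRing A] [Algebra ℂ A] {l : B → A}
    (hl : ∑ s, l s = 1) :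
    aeval (fiberedPoint e l fun s t => algebraMap ℂ A (x s t)) f = 0 := by
  classical
  -- The conditionals pass from `M` to its closure one fiber at a time: with the other fibers
  -- frozen, `f` is a polynomial on a single fiber that vanishes on `M`.
  have key : ∀ S : Finset B, ∀ y : B → T → ℂ, (∀ s ∈ S, y s ∈ zariskiClosure M) →
      (∀ s ∉ S, ∃ q ∈ M, y s = fun t => (q t : ℂ)) →
      ∀ m ∈ openSimplex B, eval (fiberedPoint e (fun s => (m s : ℂ)) y) f = 0 := by
    intro S
    induction S using Finset.induction_on with
    | empty =>
      intro y _ hy m hm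
      choose q hq hyq using fun s => hy s (Finset.notMem_empty s)
      have := mem_vanishingIdeal_zariskiClosure.1 hf
        (fun i => m (e i).1 * q (e i).1 (e i).2) ⟨m, hm, q, hq, fun _ => rfl⟩
      rw [← this]
      congr 2
      funext i
      simp [fiberedPoint, hyq]
    | insert s S hs ih =>
      intro y hy hy' m hm
      have h1 := mem_zariskiClosure.1 (hy s (Finset.mem_insert_self s S))
        (aeval (fun i => if (e i).1 = s then C (m s : ℂ) * X (e i).2
          else C (fiberedPoint e (fun s => (m s : ℂ)) y i)) f) fun p hp => ?_
      · rw [eval_aeval_eq] at h1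
        rw [← h1]
        congr 2
        funext i
        split_ifs with h
        · simp [fiberedPoint, h]
        · simp
      · rw [eval_aeval_eq]
        have h2 := ih (Function.update y s fun t => (p t : ℂ)) (fun s' hs' => ?_)
          (fun s' hs' => ?_) m hm
        · rw [← h2]
          congr 2
          funext i
          split_ifs with h
          · simp [fiberedPoint, h]
          · simp [fiberedPoint, h]
        · have : s' ≠ s := fun h => hs (h ▸ hs')
          rw [Function.update_of_ne this]
          exact hy s' (Finset.mem_insert_of_mem hs')
        · by_cases h : s' = s
          · subst h
            exact ⟨p, hp, by simp⟩
          · rw [Function.update_of_ne h]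
            exact hy' s' (by simp [h, hs'])
  -- With the conditionals fixed, `f` becomes a polynomial in the marginal alone that vanishes on
  -- the simplex.
  have h := aeval_eq_zero_of_openSimplex
    (f := aeval (fun i => X (e i).1 * C (x (e i).1 (e i).2)) f) (fun m hm => ?_) hl
  · rw [aeval_aeval_eq] at h
    rw [← h]
    congr 2
    funext i
    simp [fiberedPoint]
  · rw [eval_aeval_eq]
    have := key Finset.univ x (fun s _ => hx s) (fun s hs => absurd (Finset.mem_univ s) hs) m hm
    rw [← this]
    congr 2
    funext i
    simp [fiberedPoint]

theorem fiberedPoint_mem_zariskiClosure [Fintype B] {x : B → T → ℂ} (hx : ∀ s, x s ∈ zariskiClosure M)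
    {l : B → ℂ} (hl : ∑ s, l s = 1) :
    fiberedPoint e l x ∈ zariskiClosure (fiberedModel e M) :=
  mem_zariskiClosure.2 fun f hf => by
    simpa [aeval_eq_eval] using aeval_fiberedPoint_eq_zero (e := e)
      (mem_vanishingIdeal_zariskiClosure.2 hf) hx hl

variable [Fintype B] [Fintype T]

/-- The homogenization of an equation of `M` on one of the fibers. -/
theorem exists_fiberwise_homogenization (hM : M ⊆ openSimplex T) (s : B) {f : MvPolynomial T ℂ}
    (hf : f ∈ vanishingIdeal ℂ (zariskiClosure M)) :
    ∃ g ∈ vanishingIdeal ℂ (zariskiClosure (fiberedModel e M)), ∃ N : ℕ,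
      ∀ (A : Type) [CommRing A] [Algebra ℂ A] (y : I → A) (x : T → A) (a : A),
        (∀ t, y (e.symm (s, t)) = a * x t) → ∑ t, x t = 1 →
          aeval y g = a ^ N * aeval x f := by
  obtain ⟨g, N, hg⟩ := exists_homogenization f
  have h : ∀ (A : Type) [CommRing A] [Algebra ℂ A] (y : I → A) (x : T → A) (a : A),
      (∀ t, y (e.symm (s, t)) = a * x t) → ∑ t, x t = 1 →
        aeval y (aeval (fun t => X (e.symm (s, t))) g : MvPolynomial I ℂ)
          = a ^ N * aeval x f := by
    intro A _ _ y x a hy hx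
    rw [aeval_aeval_eq, ← hg A x a hx]
    simp only [aeval_X, hy]
  refine ⟨_, ?_, N, h⟩
  rw [mem_vanishingIdeal_zariskiClosure]
  rintro p ⟨l, hl, q, hq, hp⟩
  have := h ℂ (fun i => (p i : ℂ)) (fun t => (q s t : ℂ)) (l s) (fun t => by simp [hp])
    (by exact_mod_cast (hM (hq s)).2)
  rw [aeval_eq_eval, aeval_eq_eval] at this
  rw [this, mem_vanishingIdeal_zariskiClosure.1 hf _ (hq s), mul_zero]

/-- The homogenized equation gives `l s ^ N * f (x s) = 0`, and `l s` can be cancelled. -/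
theorem mem_zariskiClosure_of_fiberedPoint (hM : M ⊆ openSimplex T) {l : B → ℂ} {x : B → T → ℂ}
    (h : fiberedPoint e l x ∈ zariskiClosure (fiberedModel e M)) (hl : ∀ s, l s ≠ 0)
    (hx : ∀ s, ∑ t, x s t = 1) (s : B) : x s ∈ zariskiClosure M := by
  rw [mem_zariskiClosure]
  intro f hf
  obtain ⟨g, hg, N, hgN⟩ := exists_fiberwise_homogenization (e := e) hM s
    (mem_vanishingIdeal_zariskiClosure.2 hf)
  have h1 := hgN ℂ (fiberedPoint e l x) (x s) (l s) (by simp) (hx s)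
  rw [show aeval (fiberedPoint e l x) g = 0 from hg _ h] at h1
  simpa [hl s, aeval_eq_eval] using h1.symm

variable [Fintype I]

/-- Tangent vectors of the simplex and of the fibers combine to tangent vectors at a fibered point. -/
theorem fiberedPoint_tangent_of_mem {x : B → T → ℂ}
    (hx : ∀ s, x s ∈ zariskiClosure M) {l : B → ℂ} (hl : ∑ s, l s = 1) {m : B → ℂ}
    (hm : ∑ s, m s = 0) {w : B → T → ℂ}
    (hw : ∀ s, w s ∈ zariskiTangentSpace (zariskiClosure M) (x s)) :
    (fiberedPoint e m x + fiberedPoint e l w) ∈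
      zariskiTangentSpace (zariskiClosure (fiberedModel e M)) (fiberedPoint e l x) := by
  classical
  refine Submodule.add_mem _ ?_ ?_
  -- Marginal direction: `l + ε m` has coordinate sum `1` over the dual numbers.
  · refine mem_zariskiTangentSpace_of_aeval fun f hf => ?_
    have h := aeval_fiberedPoint_eq_zero hf hx (l := dualPoint l m) (by
      simp only [dualPoint, Finset.sum_add_distrib, ← TrivSqZeroExt.inl_sum,
        ← TrivSqZeroExt.inr_sum, hl, hm]
      simp)
    have h2 : (fiberedPoint e (dualPoint l m) fun s t => algebraMap ℂ (DualNumber ℂ) (x s t)) =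
        dualPoint (fiberedPoint e l x) (fiberedPoint e m x) := by
      funext i
      ext <;> simp [fiberedPoint, dualPoint, TrivSqZeroExt.algebraMap_eq_inl, mul_comm]
    rw [← h2, h, TrivSqZeroExt.snd_zero]
  -- Fiber directions: the vector is split by fiber, since freezing all fibers but `s` turns `f`
  -- into an equation of the closure of `M`.
  · have h0 : fiberedPoint e l w = ∑ s, fiberedPoint e (Pi.single s (l s)) w := by
      refine eq_of_symm e fun s t => ?_
      simp [Finset.sum_apply, Pi.single_apply]
    rw [h0]
    refine Submodule.sum_mem _ fun s _ => mem_zariskiTangentSpace_of_aeval fun f hf => ?_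
    have h := aeval_dualPoint_eq_zero (hx s) (hw s)
      (f := aeval (fun i => if (e i).1 = s then C (l s) * X (e i).2
          else C (fiberedPoint e l x i)) f) (fun y hy => ?_)
    · rw [aeval_aeval_eq] at h
      rw [show dualPoint (fiberedPoint e l x) (fiberedPoint e (Pi.single s (l s)) w) = _ from ?_, h,
        TrivSqZeroExt.snd_zero]
      funext i
      split_ifs with hi
      · ext <;> simp [fiberedPoint, dualPoint, hi, TrivSqZeroExt.algebraMap_eq_inl]
      · ext <;> simp [fiberedPoint, dualPoint, hi, TrivSqZeroExt.algebraMap_eq_inl]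
    · rw [aeval_aeval_eq]
      have := fiberedPoint_mem_zariskiClosure (e := e) (M := M) (x := Function.update x s y)
        (fun s' => ?_) hl
      · have h3 := hf _ this
        rw [← h3]
        congr 2
        funext i
        split_ifs with hi
        · simp [fiberedPoint, hi]
        · simp [fiberedPoint, hi]
      · by_cases hs : s' = s
        · subst hs; simpa using hy
        · rw [Function.update_of_ne hs]; exact hx s'

/-- Quotient rule: with `m` the fiber sum of `v`, dividing `l s * x s + ε v` by its coordinate sum
`l s + ε m` gives `x s + ε (v - m * x s) / l s`. The power of `l s + ε m` in the homogenized
equation is a unit because `l s ≠ 0`. -/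
theorem fiber_tangent_mem (hM : M ⊆ openSimplex T) {x : B → T → ℂ}
    (hx : ∀ s, x s ∈ zariskiClosure M) {l : B → ℂ} (hl : ∑ s, l s = 1) (hl0 : ∀ s, l s ≠ 0)
    {v : I → ℂ}
    (hv : v ∈ zariskiTangentSpace (zariskiClosure (fiberedModel e M)) (fiberedPoint e l x)) (s : B) :
    (fun t => (v (e.symm (s, t)) - (∑ t', v (e.symm (s, t'))) * x s t) / l s) ∈
      zariskiTangentSpace (zariskiClosure M) (x s) := by
  have hx1 : ∀ s, ∑ t, x s t = 1 := fun s => sum_eq_one_of_mem_zariskiClosure hM (hx s)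
  refine mem_zariskiTangentSpace_of_aeval fun f hf => ?_
  obtain ⟨g, hg, N, hgN⟩ := exists_fiberwise_homogenization (e := e) hM s hf
  set m := ∑ t', v (e.symm (s, t')) with hm
  set w : T → ℂ := fun t => (v (e.symm (s, t)) - m * x s t) / l s with hw
  have hwsum : ∑ t, w t = 0 := by
    simp only [hw, ← Finset.sum_div, Finset.sum_sub_distrib, ← Finset.mul_sum, hx1, ← hm]
    simp
  have h := hgN (DualNumber ℂ) (dualPoint (fiberedPoint e l x) v) (dualPoint (x s) w)
    (TrivSqZeroExt.inl (l s) + TrivSqZeroExt.inr m) (fun t => ?_) ?_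
  · rw [aeval_dualPoint_eq_zero (fiberedPoint_mem_zariskiClosure hx hl) hv hg] at h
    have hu : IsUnit ((TrivSqZeroExt.inl (l s) + TrivSqZeroExt.inr m : DualNumber ℂ) ^ N) := by
      refine IsUnit.pow _ ?_
      rw [TrivSqZeroExt.isUnit_iff_isUnit_fst]
      simpa using hl0 s
    rw [(hu.mul_right_eq_zero).1 h.symm, TrivSqZeroExt.snd_zero]
  · have := hl0 s
    ext
    · simp [dualPoint]
    · simp [dualPoint, hw]
      field_simp
      ring
  · simp only [dualPoint, Finset.sum_add_distrib, ← TrivSqZeroExt.inl_sum,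
        ← TrivSqZeroExt.inr_sum, hx1, hwsum]
    simp

theorem mem_ker_sum_proj {m : B → ℂ} :
    m ∈ LinearMap.ker (∑ s, LinearMap.proj s : (B → ℂ) →ₗ[ℂ] ℂ) ↔ ∑ s, m s = 0 := by
  simp [LinearMap.mem_ker, LinearMap.sum_apply]

/-- The tangent space at a fibered point splits into the tangent spaces of the fibers and the
tangent space of the simplex. -/
noncomputable def tangentEquiv (hM : M ⊆ openSimplex T) {x : B → T → ℂ}
    (hx : ∀ s, x s ∈ zariskiClosure M) {l : B → ℂ} (hl : ∑ s, l s = 1) (hl0 : ∀ s, l s ≠ 0) :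
    zariskiTangentSpace (zariskiClosure (fiberedModel e M)) (fiberedPoint e l x) ≃ₗ[ℂ]
      LinearMap.ker (∑ s, LinearMap.proj s : (B → ℂ) →ₗ[ℂ] ℂ) ×
        ((s : B) → zariskiTangentSpace (zariskiClosure M) (x s)) where
  toFun v := (⟨fun s => ∑ t, v.1 (e.symm (s, t)), by
      have := sum_eq_zero_of_mem_zariskiTangentSpace (fiberedModel_subset_openSimplex hM) v.2
      rw [sum_equiv_prod e] at this
      simpa using this⟩, fun s => ⟨_, fiber_tangent_mem hM hx hl hl0 v.2 s⟩)
  map_add' v w := by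
    ext s
    · simp [Finset.sum_add_distrib]
    · simp [Finset.sum_add_distrib]; ring
  map_smul' c v := by
    ext s
    · simp [Finset.mul_sum]
    · simp [← Finset.mul_sum]; ring
  invFun p := ⟨fiberedPoint e p.1.1 x + fiberedPoint e l fun s => (p.2 s).1,
    fiberedPoint_tangent_of_mem hx hl (mem_ker_sum_proj.1 p.1.2) fun s => (p.2 s).2⟩
  left_inv v := by
    ext i
    have := hl0 (e i).1
    simp [fiberedPoint]
    field_simp
    ring
  right_inv p := by
    have hx1 : ∀ s, ∑ t, x s t = 1 := fun s => sum_eq_one_of_mem_zariskiClosure hM (hx s)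
    have hw : ∀ s, ∑ t, (p.2 s).1 t = 0 := fun s =>
      sum_eq_zero_of_mem_zariskiTangentSpace hM (p.2 s).2
    ext s
    · simp [Finset.sum_add_distrib, ← Finset.mul_sum, hx1, hw]
    · have := hl0 s
      simp [Finset.sum_add_distrib, ← Finset.mul_sum, hx1, hw]
      field_simp

theorem finrank_tangent_fiberedPoint (hM : M ⊆ openSimplex T) {x : B → T → ℂ}
    (hx : ∀ s, x s ∈ zariskiClosure M) {l : B → ℂ} (hl : ∑ s, l s = 1) (hl0 : ∀ s, l s ≠ 0) :
    Module.finrank ℂ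
        (zariskiTangentSpace (zariskiClosure (fiberedModel e M)) (fiberedPoint e l x)) =
      Module.finrank ℂ (LinearMap.ker (∑ s, LinearMap.proj s : (B → ℂ) →ₗ[ℂ] ℂ)) +
        ∑ s, Module.finrank ℂ (zariskiTangentSpace (zariskiClosure M) (x s)) := by
  rw [(tangentEquiv hM hx hl hl0).finrank_eq, Module.finrank_prod, Module.finrank_pi_fintype]

/-- The tangent dimension is a constant plus a sum over fibers whose terms vary independently, so it
is minimal exactly when each term is. -/
theorem fiberedPoint_mem_regularPoints_iff (hM : M ⊆ openSimplex T) {x : B → T → ℂ}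
    (hx : ∀ s, x s ∈ zariskiClosure M) {l : B → ℂ} (hl : ∑ s, l s = 1) (hl0 : ∀ s, l s ≠ 0) :
    fiberedPoint e l x ∈ regularPoints (zariskiClosure (fiberedModel e M)) ↔
      ∀ s, x s ∈ regularPoints (zariskiClosure M) := by
  classical
  constructor
  · rintro ⟨-, h⟩ s
    refine ⟨hx s, fun w hw => ?_⟩
    have hx' : ∀ s', Function.update x s w s' ∈ zariskiClosure M := fun s' => by
      by_cases hs : s' = s
      · subst hs; simpa using hw
      · rw [Function.update_of_ne hs]; exact hx s'
    have h1 := h _ (fiberedPoint_mem_zariskiClosure hx' hl)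
    rw [finrank_tangent_fiberedPoint hM hx hl hl0, finrank_tangent_fiberedPoint hM hx' hl hl0]
      at h1
    have h2 := Finset.add_sum_erase Finset.univ (fun s' => Module.finrank ℂ
      (zariskiTangentSpace (zariskiClosure M) (x s'))) (Finset.mem_univ s)
    have h3 := Finset.add_sum_erase Finset.univ (fun s' => Module.finrank ℂ
      (zariskiTangentSpace (zariskiClosure M) (Function.update x s w s'))) (Finset.mem_univ s)
    have h4 : ∑ s' ∈ Finset.univ.erase s, Module.finrank ℂ
        (zariskiTangentSpace (zariskiClosure M) (Function.update x s w s')) =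
        ∑ s' ∈ Finset.univ.erase s, Module.finrank ℂ
          (zariskiTangentSpace (zariskiClosure M) (x s')) :=
      Finset.sum_congr rfl fun s' hs' => by
        rw [Function.update_of_ne (Finset.ne_of_mem_erase hs')]
    rw [Function.update_self] at h3
    omega
  · intro h
    refine ⟨fiberedPoint_mem_zariskiClosure hx hl, fun w hw => ?_⟩
    -- The point `w` may have a vanishing fiber sum and then no splitting of its tangent space is
    -- available; semicontinuity replaces it by a point of the model.
    obtain ⟨p, hp, hpw⟩ := exists_finrank_zariskiTangentSpace_le hw
    refine le_trans ?_ hpw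
    obtain ⟨l', hl', q, hq, hpq⟩ := hp
    have : (fun i => (p i : ℂ)) =
        fiberedPoint e (fun s => (l' s : ℂ)) fun s t => (q s t : ℂ) := by
      funext i; simp [hpq, fiberedPoint]
    rw [this, finrank_tangent_fiberedPoint hM hx hl hl0, finrank_tangent_fiberedPoint hM
      (fun s => coe_mem_zariskiClosure (hq s)) (by exact_mod_cast hl'.2)
      (fun s => by exact_mod_cast (hl'.1 s).ne')]
    exact Nat.add_le_add_left
      (Finset.sum_le_sum fun s _ => (h s).2 _ (coe_mem_zariskiClosure (hq s))) _

end Fibered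

/-! ### Critical points of fibered models -/

section Critical

open MvPolynomial

variable {I B T : Type*} {e : I ≃ B × T} {M : Set (T → ℝ)}
variable [Fintype I] [Fintype B] [Fintype T]

/-- The direction that trades mass between two fibers is tangent. -/
theorem fiber_exchange_tangent (hM : M ⊆ openSimplex T) [DecidableEq B] {p : I → ℂ}
    (hp : p ∈ zariskiClosure (fiberedModel e M)) (a b : B) :
    (fun i => ((if (e i).1 = a then ∑ t, p (e.symm (b, t)) else 0) -
        (if (e i).1 = b then ∑ t, p (e.symm (a, t)) else 0)) * p i) ∈
      zariskiTangentSpace (zariskiClosure (fiberedModel e M)) p := by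
  intro f hf
  -- The direction is polynomial in the point, so tangency is a polynomial condition and need only
  -- be checked on the model. There it is the marginal direction adding `l a * l b` to fiber `a` and
  -- removing it from fiber `b`.
  have key := mem_zariskiClosure.1 hp
    (∑ i, pderiv i f * (((if (e i).1 = a then ∑ t, X (e.symm (b, t)) else 0) -
        (if (e i).1 = b then ∑ t, X (e.symm (a, t)) else 0)) * X i)) ?_
  · simpa [apply_ite (eval p)] using key
  rintro q ⟨l, hl, x, hx, hq⟩
  have hz : (fun i => (q i : ℂ)) = fiberedPoint e (fun s => (l s : ℂ)) fun s t => (x s t : ℂ) := by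
    funext i; simp [hq, fiberedPoint]
  have hx1 : ∀ s, ∑ t, (x s t : ℂ) = 1 := fun s => by exact_mod_cast (hM (hx s)).2
  have h := fiberedPoint_tangent_of_mem (e := e) (M := M)
    (fun s => coe_mem_zariskiClosure (hx s)) (l := fun s => (l s : ℂ)) (by exact_mod_cast hl.2)
    (m := fun s => (if s = a then (l b : ℂ) * l a else 0) - if s = b then (l a : ℂ) * l b else 0)
    (by simp [mul_comm]) (w := 0) (fun s => Submodule.zero_mem _) f hf
  rw [← hz] at h
  rw [map_sum, ← h]
  refine Finset.sum_congr rfl fun i _ => ?_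
  have hsum : ∀ s, ∑ t, (q (e.symm (s, t)) : ℂ) = l s := fun s => by
    simp [hq, ← Finset.mul_sum, hx1]
  rw [map_mul]
  congr 1
  have hqi : (q i : ℂ) = l (e i).1 * x (e i).1 (e i).2 := by rw [hq, Complex.ofReal_mul]
  simp only [map_mul, map_sub, apply_ite (eval _), map_sum, eval_X, hsum, map_zero, Pi.add_apply,
    fiberedPoint, Pi.zero_apply, mul_zero, add_zero, hqi]
  generalize (e i).1 = c
  split_ifs <;> subst_vars <;> ring

/-- The data on the fiber over `s`. -/
def fiberData (e : I ≃ B × T) (u : I → ℂ) (s : B) (t : T) : ℂ := u (e.symm (s, t))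

/-- Criticality along the exchange of fibers `a` and `s` says that the fiber sums of `u` and `p` are
proportional; summing over `a` fixes the factor. The marginal of a critical point is thus determined
by the data. -/
theorem fiber_sum_of_mem_criticalPoints (hM : M ⊆ openSimplex T) {u p : I → ℂ}
    (hp : p ∈ criticalPoints (zariskiClosure (fiberedModel e M)) u) (s : B) :
    (∑ i, u i) * ∑ t, p (e.symm (s, t)) = ∑ t, fiberData e u s t := by
  classical
  have hsum := sum_eq_one_of_mem_zariskiClosure (fiberedModel_subset_openSimplex hM) hp.1.1
  rw [sum_equiv_prod e] at hsum
  have h : ∀ a, (∑ t, fiberData e u a t) * ∑ t, p (e.symm (s, t)) =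
      (∑ t, fiberData e u s t) * ∑ t, p (e.symm (a, t)) := fun a => by
    have := hp.2.2 _ (fiber_exchange_tangent hM hp.1.1 a s)
    rw [sum_equiv_prod e] at this
    have h2 : ∀ c t (y : ℂ), u (e.symm (c, t)) / p (e.symm (c, t)) * (y * p (e.symm (c, t))) =
        fiberData e u c t * y := fun c t y => by
      have := hp.2.1 (e.symm (c, t))
      rw [fiberData]
      field_simp
    simp only [h2, Equiv.apply_symm_apply] at this
    simp only [← Finset.sum_mul] at this
    simp only [mul_sub, mul_ite, mul_zero, Finset.sum_sub_distrib, Finset.sum_ite_eq',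
      Finset.mem_univ, if_true] at this
    exact sub_eq_zero.1 this
  rw [sum_equiv_prod e, Finset.sum_mul]
  have h3 := Finset.sum_congr rfl fun a (_ : a ∈ Finset.univ) => h a
  rw [← Finset.mul_sum, hsum, mul_one] at h3
  exact h3

/-- In a direction along fiber `s` the factors `l s` cancel and leave the critical equation of that
fiber. In the remaining marginal directions the differential is `∑ i, u i` times the total of `v`,
by `hlu`, and that total is zero. -/
theorem fiberedPoint_mem_criticalPoints_iff (hM : M ⊆ openSimplex T) {u : I → ℂ}
    {x : B → T → ℂ} (hx : ∀ s, x s ∈ zariskiClosure M) {l : B → ℂ} (hl : ∑ s, l s = 1)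
    (hl0 : ∀ s, l s ≠ 0) (hlu : ∀ s, (∑ i, u i) * l s = ∑ t, fiberData e u s t) :
    fiberedPoint e l x ∈ criticalPoints (zariskiClosure (fiberedModel e M)) u ↔
      ∀ s, x s ∈ criticalPoints (zariskiClosure M) (fiberData e u s) := by
  classical
  constructor
  · rintro ⟨h1, h2, h3⟩ s
    have hx0 : ∀ s t, x s t ≠ 0 := fun s t => by
      have := h2 (e.symm (s, t))
      rw [fiberedPoint_symm] at this
      exact right_ne_zero_of_mul this
    refine ⟨(fiberedPoint_mem_regularPoints_iff hM hx hl hl0).1 h1 s, hx0 s, fun w hw => ?_⟩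
    have := h3 _ (fiberedPoint_tangent_of_mem hx hl (m := 0) (by simp)
      (w := fun s' => if h : s' = s then w else 0) (fun s' => by
        split_ifs with h
        · subst h; exact hw
        · exact Submodule.zero_mem _))
    rw [sum_equiv_prod e, Finset.sum_eq_single s] at this
    · rw [← this]
      refine Finset.sum_congr rfl fun t _ => ?_
      have h4 := hl0 s
      have h5 := hx0 s t
      simp only [fiberData, Pi.add_apply, fiberedPoint_symm, Pi.zero_apply, dif_pos]
      field_simp
      ring
    · intro s' _ hs'
      simp [hs']
    · simp
  · intro h
    have hx0 : ∀ s t, x s t ≠ 0 := fun s t => (h s).2.1 t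
    refine ⟨(fiberedPoint_mem_regularPoints_iff hM hx hl hl0).2 fun s => (h s).1,
      fun i => mul_ne_zero (hl0 _) (hx0 _ _), fun v hv => ?_⟩
    have hv0 := sum_eq_zero_of_mem_zariskiTangentSpace (fiberedModel_subset_openSimplex hM) hv
    rw [sum_equiv_prod e] at hv0 ⊢
    have hs : ∀ s, ∑ t, u (e.symm (s, t)) / fiberedPoint e l x (e.symm (s, t)) * v (e.symm (s, t))
        = (∑ i, u i) * ∑ t, v (e.symm (s, t)) := fun s => by
      have h1 := (h s).2.2 _ (fiber_tangent_mem hM hx hl hl0 hv s)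
      set m := ∑ t', v (e.symm (s, t'))
      have h4 := hl0 s
      have h6 : ∑ t, fiberData e u s t / l s * m = (∑ i, u i) * m := by
        rw [← Finset.sum_mul, ← Finset.sum_div, ← hlu s, mul_div_cancel_right₀ _ h4]
      rw [← h6, ← sub_eq_zero, ← h1, ← Finset.sum_sub_distrib]
      refine Finset.sum_congr rfl fun t _ => ?_
      have h5 := hx0 s t
      simp only [fiberData, fiberedPoint_symm]
      field_simp
    rw [Finset.sum_congr rfl fun s _ => hs s, ← Finset.mul_sum, hv0, mul_zero]

/-- Normalizing each fiber is a bijection from the critical points to families of critical points of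
the fibers. Nonzero sums of the data make the forced marginal `l` well defined and nowhere zero. -/
theorem encard_criticalPoints_fiberedModel (hM : M ⊆ openSimplex T) {u : I → ℂ}
    (hu : ∑ i, u i ≠ 0) (hus : ∀ s, ∑ t, fiberData e u s t ≠ 0) :
    (criticalPoints (zariskiClosure (fiberedModel e M)) u).encard =
      ∏ s, (criticalPoints (zariskiClosure M) (fiberData e u s)).encard := by
  set l : B → ℂ := fun s => (∑ t, fiberData e u s t) / ∑ i, u i with hldef
  have hlu : ∀ s, (∑ i, u i) * l s = ∑ t, fiberData e u s t := fun s => by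
    rw [hldef]; field_simp
  have hl0 : ∀ s, l s ≠ 0 := fun s => div_ne_zero (hus s) hu
  have hl : ∑ s, l s = 1 := by
    rw [hldef, ← Finset.sum_div, div_eq_one_iff_eq hu, sum_equiv_prod e]
    rfl
  rw [← Set.encard_pi_eq_prod_encard]
  have hinj : Function.Injective (fiberedPoint e l : (B → T → ℂ) → I → ℂ) := fun x y hxy => by
    funext s t
    have := congrFun hxy (e.symm (s, t))
    simpa [hl0 s] using this
  rw [← hinj.encard_image]
  congr 1
  ext p
  constructor
  · intro hp
    have hps : ∀ s, ∑ t, p (e.symm (s, t)) = l s := fun s => by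
      have := fiber_sum_of_mem_criticalPoints hM hp s
      rw [← hlu s] at this
      exact mul_left_cancel₀ hu this
    set x : B → T → ℂ := fun s t => p (e.symm (s, t)) / l s with hxdef
    have hpx : fiberedPoint e l x = p := eq_of_symm e fun s t => by
      rw [fiberedPoint_symm, hxdef]
      exact mul_div_cancel₀ _ (hl0 s)
    rw [← hpx] at hp
    have hx := mem_zariskiClosure_of_fiberedPoint hM hp.1.1 hl0 fun s => by
      rw [hxdef, ← Finset.sum_div, hps, div_self (hl0 s)]
    exact ⟨x, fun s _ => (fiberedPoint_mem_criticalPoints_iff hM hx hl hl0 hlu).1 hp s, hpx⟩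
  · rintro ⟨x, hx, rfl⟩
    exact (fiberedPoint_mem_criticalPoints_iff hM (fun s => (hx s trivial).1.1) hl hl0 hlu).2
      fun s => hx s trivial

end Critical

/-! ### Generic values of products -/

section Generic

open MvPolynomial

variable {I B T : Type*} {e : I ≃ B × T}

/-- The polynomial in one block of coordinates obtained by fixing the other blocks. -/
theorem exists_restrict_block [DecidableEq B] (F : MvPolynomial I ℂ) (u : I → ℂ) (s : B) :
    ∃ Q : MvPolynomial T ℂ, ∀ y,
      eval y Q = eval (fun i => if (e i).1 = s then y (e i).2 else u i) F := by
  refine ⟨aeval (fun i => if (e i).1 = s then X (e i).2 else C (u i)) F, fun y => ?_⟩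
  rw [eval_aeval_eq]
  congr 2
  funext i
  split_ifs <;> simp

/-- A power of a Zariski dense set is Zariski dense: blocks are moved into `P` one at a time,
keeping `F` nonzero. -/
theorem exists_eval_ne_zero_of_dense [Fintype B] {P : Set (T → ℂ)}
    (hP : ∀ Q : MvPolynomial T ℂ, Q ≠ 0 → ∃ y ∈ P, eval y Q ≠ 0)
    {F : MvPolynomial I ℂ} (hF : F ≠ 0) :
    ∃ u : I → ℂ, eval u F ≠ 0 ∧ ∀ s, fiberData e u s ∈ P := by
  classical
  have key : ∀ S : Finset B, ∃ u : I → ℂ, eval u F ≠ 0 ∧ ∀ s ∈ S, fiberData e u s ∈ P := by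
    intro S
    induction S using Finset.induction_on with
    | empty =>
      by_contra! h
      refine hF (MvPolynomial.funext fun u => ?_)
      by_contra hu
      obtain ⟨s, hs, -⟩ := h u (by simpa using hu)
      exact Finset.notMem_empty s hs
    | insert s S hs ih =>
      obtain ⟨u, hu, huS⟩ := ih
      obtain ⟨Q, hQ⟩ := exists_restrict_block (e := e) F u s
      have hQu : eval (fiberData e u s) Q = eval u F := by
        rw [hQ]
        congr 2
        funext i
        split_ifs with h
        · rw [fiberData, ← h, Prod.mk.eta, Equiv.symm_apply_apply]
        · rfl
      obtain ⟨y, hy, hyQ⟩ := hP Q (by rintro rfl; exact hu (by rw [← hQu, map_zero]))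
      refine ⟨_, hQ y ▸ hyQ, fun s' hs' => ?_⟩
      by_cases h : s' = s
      · subst h
        convert hy
        funext t
        simp [fiberData]
      · convert huS s' (Finset.mem_of_mem_insert_of_ne hs' h) using 1
        funext t
        simp [fiberData, h]
  obtain ⟨u, hu, h⟩ := key Finset.univ
  exact ⟨u, hu, fun s => h s (Finset.mem_univ s)⟩

/-- If `m ≠ 0`, freezing all blocks but one at a generic point leaves a finite nonzero cofactor,
which cancels and makes `f` generically constant. -/
theorem exists_generic_value [Fintype B] [Nonempty B] {f : (T → ℂ) → ℕ∞} {m : ℕ}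
    {F : MvPolynomial I ℂ} (hF : F ≠ 0)
    (h : ∀ u : I → ℂ, eval u F ≠ 0 → ∏ s, f (fiberData e u s) = m) :
    ∃ N : ℕ, (∃ Q : MvPolynomial T ℂ, Q ≠ 0 ∧ ∀ y, eval y Q ≠ 0 → f y = N) ∧
      m = N ^ Fintype.card B := by
  classical
  rcases eq_or_ne m 0 with rfl | hm
  · refine ⟨0, ?_, by simp [Fintype.card_ne_zero]⟩
    -- Cancellation is impossible for `m = 0`. Instead, if `f` were not generically zero, the set
    -- where `f ≠ 0` would be dense, and a generic `u` with all blocks in it would have a nonzero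
    -- product.
    by_contra! hcon
    obtain ⟨u, hu, hus⟩ := exists_eval_ne_zero_of_dense (e := e) (P := {y | f y ≠ 0})
      (fun Q hQ => by
        obtain ⟨y, hy, hy'⟩ := hcon Q hQ
        exact ⟨y, by simpa using hy', hy⟩) hF
    have := h u hu
    rw [Nat.cast_zero, Finset.prod_eq_zero_iff] at this
    obtain ⟨s, -, hs⟩ := this
    exact hus s hs
  · obtain ⟨u, hu, -⟩ := exists_eval_ne_zero_of_dense (e := e) (P := Set.univ)
      (fun Q hQ => by
        by_contra! hcon
        exact hQ (MvPolynomial.funext fun y => by rw [hcon y trivial, map_zero])) hF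
    let s : B := Classical.arbitrary B
    obtain ⟨Q, hQ⟩ := exists_restrict_block (e := e) F u s
    have hQu : eval (fiberData e u s) Q = eval u F := by
      rw [hQ]
      congr 2
      funext i
      split_ifs with h
      · rw [fiberData, ← h, Prod.mk.eta, Equiv.symm_apply_apply]
      · rfl
    have hQ0 : Q ≠ 0 := by rintro rfl; exact hu (by rw [← hQu, map_zero])
    have hprod := h u hu
    rw [← Finset.mul_prod_erase _ _ (Finset.mem_univ s)] at hprod
    set R := ∏ s' ∈ Finset.univ.erase s, f (fiberData e u s') with hR
    have hm' : (m : ℕ∞) ≠ 0 := by exact_mod_cast hm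
    have hR0 : R ≠ 0 := fun h0 => hm' (by rw [← hprod, h0, mul_zero])
    have hf0 : f (fiberData e u s) ≠ 0 := fun h0 => hm' (by rw [← hprod, h0, zero_mul])
    have hRt : R ≠ ⊤ := fun ht => ENat.natCast_ne_top m (by rw [← hprod, ht, ENat.mul_top hf0])
    have hft : f (fiberData e u s) ≠ ⊤ := fun ht =>
      ENat.natCast_ne_top m (by rw [← hprod, ht, ENat.top_mul hR0])
    obtain ⟨N, hN⟩ := ENat.ne_top_iff_exists.1 hft
    have hgen : ∀ y, eval y Q ≠ 0 → f y = N := fun y hy => by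
      rw [hQ] at hy
      have h1 := h _ hy
      rw [← Finset.mul_prod_erase _ _ (Finset.mem_univ s), ← hprod] at h1
      have h2 : fiberData e (fun i => if (e i).1 = s then y (e i).2 else u i) s = y := by
        funext t; simp [fiberData]
      have h3 : ∏ s' ∈ Finset.univ.erase s,
          f (fiberData e (fun i => if (e i).1 = s then y (e i).2 else u i) s') = R := by
        refine Finset.prod_congr rfl fun s' hs' => ?_
        congr 1
        funext t
        simp [fiberData, Finset.ne_of_mem_erase hs']
      rw [h2, h3] at h1
      rw [hN]
      exact (ENat.mul_left_strictMono hR0 hRt).injective h1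
    refine ⟨N, ⟨Q, hQ0, hgen⟩, ?_⟩
    -- All blocks are now taken in the generic locus of `f` at once, so the product is a pure power
    -- of `N`.
    obtain ⟨v, hv, hvs⟩ := exists_eval_ne_zero_of_dense (e := e) (P := {y | eval y Q ≠ 0})
      (fun Q' hQ' => by
        by_contra! hcon
        refine mul_ne_zero hQ0 hQ' (MvPolynomial.funext fun y => ?_)
        rw [map_zero, map_mul]
        by_cases hy : eval y Q = 0
        · rw [hy, zero_mul]
        · rw [hcon y hy, mul_zero]) hF
    have h1 := h v hv
    rw [Finset.prod_congr rfl fun s _ => hgen _ (hvs s), Finset.prod_const, Finset.card_univ] at h1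
    exact_mod_cast h1.symm

theorem sum_X_ne_zero (I : Type*) [Fintype I] [Nonempty I] : (∑ i, X i : MvPolynomial I ℂ) ≠ 0 := by
  intro h
  have := congrArg (eval fun _ => (1 : ℂ)) h
  simp at this

theorem isMLDegree_fiberedModel_iff [Fintype I] [Fintype B] [Fintype T] [Nonempty B] [Nonempty T]
    {M : Set (T → ℝ)} (hM : M ⊆ openSimplex T) (m : ℕ) :
    IsMLDegree (fiberedModel e M) m ↔ ∃ N : ℕ, IsMLDegree M N ∧ m = N ^ Fintype.card B := by
  have hrename : ∀ (s : B) (Q : MvPolynomial T ℂ) (u : I → ℂ),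
      eval u (rename (fun t => e.symm (s, t)) Q) = eval (fiberData e u s) Q := fun s Q u => by
    rw [eval_rename]; rfl
  have hrename0 : ∀ (s : B) {Q : MvPolynomial T ℂ}, Q ≠ 0 →
      rename (fun t => e.symm (s, t)) Q ≠ 0 := fun s Q hQ h =>
    hQ (rename_injective (fun t => e.symm (s, t)) (fun a b hab => by simpa using hab)
      (by rw [h, map_zero]))
  have : Nonempty I := e.nonempty
  -- `D` excludes data whose total or some fiber sum vanishes.
  set D : MvPolynomial I ℂ :=
    (∑ i, X i) * ∏ s, rename (fun t => e.symm (s, t)) (∑ t, X t) with hD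
  have hD0 : D ≠ 0 := mul_ne_zero (sum_X_ne_zero I)
    (Finset.prod_ne_zero_iff.2 fun s _ => hrename0 s (sum_X_ne_zero T))
  have hDu : ∀ u, eval u D ≠ 0 → (criticalPoints (zariskiClosure (fiberedModel e M)) u).encard =
      ∏ s, (criticalPoints (zariskiClosure M) (fiberData e u s)).encard := fun u hu => by
    rw [hD, map_mul, map_prod] at hu
    refine encard_criticalPoints_fiberedModel hM ?_ fun s => ?_
    · simpa using left_ne_zero_of_mul hu
    · have := Finset.prod_ne_zero_iff.1 (right_ne_zero_of_mul hu) s (Finset.mem_univ s)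
      rw [hrename] at this
      simpa using this
  constructor
  · rintro ⟨F, hF, h⟩
    exact exists_generic_value (e := e) (mul_ne_zero hF hD0) fun u hu => by
      rw [map_mul] at hu
      rw [← hDu u (right_ne_zero_of_mul hu), h u (left_ne_zero_of_mul hu)]
  · rintro ⟨N, ⟨Q, hQ, h⟩, rfl⟩
    refine ⟨D * ∏ s, rename (fun t => e.symm (s, t)) Q, mul_ne_zero hD0
      (Finset.prod_ne_zero_iff.2 fun s _ => hrename0 s hQ), fun u hu => ?_⟩
    rw [map_mul, map_prod] at hu
    rw [hDu u (left_ne_zero_of_mul hu), Finset.prod_congr rfl fun s hs => h _ (by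
      have := Finset.prod_ne_zero_iff.1 (right_ne_zero_of_mul hu) s hs
      rwa [hrename] at this), Finset.prod_const, Finset.card_univ]
    push_cast
    rfl

end Generic

/-! ### Mixtures of fibered models -/

section Mixture

variable {I B T : Type*} [Fintype B] {e : I ≃ B × T}

theorem mixture_subset_openSimplex [Fintype T] {M : Set (T → ℝ)} (hM : M ⊆ openSimplex T) {r : ℕ}
    (hr : 1 ≤ r) : mixture r M ⊆ openSimplex T := by
  have : Nonempty (Fin r) := ⟨⟨0, hr⟩⟩
  rintro p ⟨w, hw, q, hq, hp⟩
  refine ⟨fun i => ?_, ?_⟩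
  · rw [hp]
    exact Finset.sum_pos (fun j _ => mul_pos (hw.1 j) ((hM (hq j)).1 i)) Finset.univ_nonempty
  · simp only [hp]
    rw [Finset.sum_comm]
    simp only [← Finset.mul_sum, (hM (hq _)).2, mul_one, hw.2]

/-- Bayes' rule: the joint law of mixture component `j` and base state `s` factors either as the law
of `j` times that of `s` given `j`, or as the law of `s` times that of `j` given `s`. Both
factorizations are unrestricted, as the marginals on `B` are arbitrary. -/
theorem mixture_fiberedModel [Nonempty B] (M : Set (T → ℝ)) {r : ℕ} (hr : 1 ≤ r) :
    mixture r (fiberedModel e M) = fiberedModel e (mixture r M) := by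
  have : Nonempty (Fin r) := ⟨⟨0, hr⟩⟩
  ext p
  constructor
  · rintro ⟨w, hw, q, hq, hp⟩
    choose c hc x hx hq using hq
    have hpos : ∀ s, 0 < ∑ j, w j * c j s := fun s =>
      Finset.sum_pos (fun j _ => mul_pos (hw.1 j) ((hc j).1 s)) Finset.univ_nonempty
    refine ⟨fun s => ∑ j, w j * c j s, ⟨hpos, ?_⟩,
      fun s t => ∑ j, w j * c j s / (∑ j, w j * c j s) * x j s t, fun s => ?_, fun i => ?_⟩
    · rw [Finset.sum_comm]
      simp only [← Finset.mul_sum, (hc _).2, mul_one, hw.2]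
    · refine ⟨fun j => w j * c j s / ∑ j, w j * c j s,
        ⟨fun j => div_pos (mul_pos (hw.1 j) ((hc j).1 s)) (hpos s), ?_⟩, fun j => x j s,
        fun j => hx j s, fun t => rfl⟩
      rw [← Finset.sum_div, div_self (hpos s).ne']
    · rw [hp, Finset.mul_sum]
      refine Finset.sum_congr rfl fun j _ => ?_
      have := (hpos (e i).1).ne'
      rw [hq]
      field_simp
  · rintro ⟨l, hl, x, hx, hp⟩
    choose w hw q hq hx using hx
    have hpos : ∀ j, 0 < ∑ s, l s * w s j := fun j =>
      Finset.sum_pos (fun s _ => mul_pos (hl.1 s) ((hw s).1 j)) Finset.univ_nonempty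
    refine ⟨fun j => ∑ s, l s * w s j, ⟨hpos, ?_⟩,
      fun j i => l (e i).1 * w (e i).1 j / (∑ s, l s * w s j) * q (e i).1 j (e i).2,
      fun j => ?_, fun i => ?_⟩
    · rw [Finset.sum_comm]
      simp only [← Finset.mul_sum, (hw _).2, mul_one, hl.2]
    · refine ⟨fun s => l s * w s j / ∑ s, l s * w s j,
        ⟨fun s => div_pos (mul_pos (hl.1 s) ((hw s).1 j)) (hpos j), ?_⟩, fun s => q s j,
        fun s => hq s j, fun i => rfl⟩
      rw [← Finset.sum_div, div_self (hpos j).ne']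
    · rw [hp, hx, Finset.mul_sum]
      refine Finset.sum_congr rfl fun j _ => ?_
      have := (hpos j).ne'
      field_simp

end Mixture

/-! ### Positive tensors of rank one -/

section RankOne

variable {k : ℕ} {n : Fin k → ℕ}

theorem independenceModel_subset_openSimplex :
    independenceModel n ⊆ openSimplex ((l : Fin k) → Fin (n l)) := fun _ hp => hp.1

/-- A probability tensor that is a product of complex vectors is a product of probability
distributions. -/
theorem mem_independenceModel_of_complex {p : ((l : Fin k) → Fin (n l)) → ℝ}
    (hp : p ∈ openSimplex ((l : Fin k) → Fin (n l)))
    {ψ : (l : Fin k) → Fin (n l) → ℂ} (h : ∀ t, (p t : ℂ) = ∏ l, ψ l (t l)) :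
    p ∈ independenceModel n := by
  classical
  -- The real factors are the marginals of `p`.
  refine ⟨hp, fun l a => ∑ t, if t l = a then p t else 0, fun l => ⟨fun a => ?_, ?_⟩, fun t => ?_⟩
  · have hne : Nonempty ((l : Fin k) → Fin (n l)) := by
      by_contra hcon
      rw [not_nonempty_iff] at hcon
      simpa using hp.2
    obtain ⟨t⟩ := hne
    refine Finset.sum_pos' (fun t _ => ?_) ⟨Function.update t l a, Finset.mem_univ _, ?_⟩
    · split_ifs
      · exact (hp.1 t).le
      · exact le_rfl
    · simpa using hp.1 _
  · rw [Finset.sum_comm]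
    simpa using hp.2
  · have htot : ∏ l, ∑ a, ψ l a = 1 := by
      rw [Fintype.prod_sum]
      simp only [← h]
      exact_mod_cast hp.2
    have hmarg : ∀ l a, ((∑ t, if t l = a then p t else 0 : ℝ) : ℂ) =
        ψ l a * ∏ l' ∈ Finset.univ.erase l, ∑ b, ψ l' b := fun l a => by
      have h1 : ∀ t : (l : Fin k) → Fin (n l), ((if t l = a then p t else 0 : ℝ) : ℂ) =
          ∏ l', if l' = l then (if t l = a then ψ l' (t l') else 0) else ψ l' (t l') := fun t => by
        split_ifs with hta
        · rw [h]; exact Finset.prod_congr rfl fun l' _ => by split_ifs <;> rfl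
        · rw [Finset.prod_eq_zero (Finset.mem_univ l)] <;> simp
      -- `b` and `a` live in different types until `l' = l` is known, so they are compared as
      -- natural numbers.
      let g : (l' : Fin k) → Fin (n l') → ℂ := fun l' b =>
        if l' = l then (if (b : ℕ) = a then ψ l' b else 0) else ψ l' b
      have h2 : ∀ t : (l : Fin k) → Fin (n l),
          (∏ l', if l' = l then (if t l = a then ψ l' (t l') else 0) else ψ l' (t l')) =
          ∏ l', g l' (t l') := fun t => by
        refine Finset.prod_congr rfl fun l' _ => ?_
        by_cases hl : l' = l
        · subst hl; simp [g, Fin.ext_iff]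
        · simp [g, hl]
      rw [Complex.ofReal_sum, Finset.sum_congr rfl fun t _ => (h1 t).trans (h2 t),
        ← Fintype.prod_sum g, ← Finset.mul_prod_erase _ _ (Finset.mem_univ l)]
      congr 1
      · simp [g, ← Fin.ext_iff]
      · exact Finset.prod_congr rfl fun l' hl' => by
          simp [g, Finset.ne_of_mem_erase hl']
    have : (p t : ℂ) = ((∏ l, ∑ t', if t' l = t l then p t' else 0 : ℝ) : ℂ) := by
      rw [Complex.ofReal_prod, h]
      simp only [hmarg, Finset.prod_mul_distrib]
      -- The totals of the `ψ l` multiply to `1`, so the correction factors are their inverses and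
      -- also multiply to `1`.
      have h3 : ∏ l, ∏ l' ∈ Finset.univ.erase l, ∑ b, ψ l' b = 1 := by
        have h4 : ∀ l, (∑ b, ψ l b) ≠ 0 := fun l hl => by
          rw [Finset.prod_eq_zero (Finset.mem_univ l) hl] at htot
          exact zero_ne_one htot
        have h5 : ∀ l, ∏ l' ∈ Finset.univ.erase l, ∑ b, ψ l' b = (∑ b, ψ l b)⁻¹ := fun l => by
          refine eq_inv_of_mul_eq_one_right ?_
          rw [Finset.mul_prod_erase Finset.univ (fun l' => ∑ b, ψ l' b) (Finset.mem_univ l), htot]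
        simp only [h5, Finset.prod_inv_distrib, htot, inv_one]
      rw [h3, mul_one]
    exact_mod_cast this

end RankOne

/-! ### Clique stars -/

section CliqueStar

variable {V : Type*} [Fintype V] [DecidableEq V] {G : SimpleGraph V} {d : V → ℕ} {k : ℕ}
  {C : Fin k → Finset V} {S : Finset V}

theorem IsCliqueStar.exists_mem (hG : IsCliqueStar G C S) (v : V) : v ∈ S ∨ ∃ l, v ∈ C l := by
  obtain ⟨K, hvK, hK⟩ := (Set.toFinite {T : Finset V | G.IsClique (T : Set V)}).exists_le_maximal
    (a := {v}) (by simp)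
  obtain ⟨l, rfl⟩ := (hG.mem_maximalCliques_iff K).1 (by simpa [maximalCliques] using hK)
  have := hvK (Finset.mem_singleton_self v)
  rw [Finset.mem_union] at this
  exact this.elim (fun h => Or.inr ⟨l, h⟩) Or.inl

/-- The empty clique lies in a maximal one. A leaf is needed to absorb normalizing constants and the
marginal of the center. -/
theorem IsCliqueStar.pos (hG : IsCliqueStar G C S) : 0 < k := by
  obtain ⟨K, -, hK⟩ := (Set.toFinite {T : Finset V | G.IsClique (T : Set V)}).exists_le_maximal
    (a := ∅) (by simp)
  obtain ⟨l, -⟩ := (hG.mem_maximalCliques_iff K).1 (by simpa [maximalCliques] using hK)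
  exact l.pos

theorem IsCliqueStar.eq_of_mem (hG : IsCliqueStar G C S) {v : V} {l m : Fin k} (hl : v ∈ C l)
    (hm : v ∈ C m) : l = m := by
  by_contra h
  have hv : v ∈ (C l ∪ S) ∩ (C m ∪ S) := by simp [hl, hm]
  rw [hG.inter_eq l m h] at hv
  exact Finset.disjoint_left.1 (hG.disjoint l) hl hv

theorem IsCliqueStar.maximalCliques_eq (hG : IsCliqueStar G C S) :
    maximalCliques G = Finset.univ.image fun l => C l ∪ S := by
  ext K
  simp [hG.mem_maximalCliques_iff]

/-- The joint states of a set of nodes are numbered. -/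
noncomputable def leafEquiv (d : V → ℕ) (A : Finset V) :
    ((v : A) → Fin (d v)) ≃ Fin (∏ v ∈ A, d v) :=
  Fintype.equivFinOfCardEq (by simp [Finset.prod_attach A d])

/-- Restriction of a joint state to the center and the leaves. -/
noncomputable def starMap (d : V → ℕ) (C : Fin k → Finset V) (S : Finset V)
    (i : (v : V) → Fin (d v)) :
    ((v : S) → Fin (d v)) × ((l : Fin k) → Fin (∏ v ∈ C l, d v)) :=
  (fun v => i v, fun l => leafEquiv d (C l) fun v => i v)

theorem IsCliqueStar.starMap_bijective (hG : IsCliqueStar G C S) (d : V → ℕ) :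
    Function.Bijective (starMap d C S) := by
  constructor
  · intro i j hij
    rw [starMap, starMap, Prod.mk.injEq] at hij
    funext v
    rcases hG.exists_mem v with hv | ⟨l, hv⟩
    · exact congrFun hij.1 ⟨v, hv⟩
    · exact congrFun ((leafEquiv d (C l)).injective (congrFun hij.2 l)) ⟨v, hv⟩
  · rintro ⟨a, b⟩
    choose f hf using fun v (hv : v ∉ S) => (hG.exists_mem v).resolve_left hv
    refine ⟨fun v => if hv : v ∈ S then a ⟨v, hv⟩
      else (leafEquiv d (C (f v hv))).symm (b (f v hv)) ⟨v, hf v hv⟩, ?_⟩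
    refine Prod.ext (funext fun v => by simp [starMap]) (funext fun l => ?_)
    rw [starMap, ← Equiv.eq_symm_apply]
    funext v
    have hv : (v : V) ∉ S := Finset.disjoint_left.1 (hG.disjoint l) v.2
    have key : ∀ m (hm : (v : V) ∈ C m), m = l →
        (leafEquiv d (C m)).symm (b m) ⟨v, hm⟩ = (leafEquiv d (C l)).symm (b l) v := by
      rintro m hm rfl
      rfl
    simp only [dif_neg hv]
    exact key _ _ (hG.eq_of_mem (hf v hv) v.2)

/-- The joint states of a clique star are the pairs of joint states of the center and tuples of
joint states of the leaves. -/
noncomputable def IsCliqueStar.equiv (hG : IsCliqueStar G C S) (d : V → ℕ) :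
    ((v : V) → Fin (d v)) ≃
      ((v : S) → Fin (d v)) × ((l : Fin k) → Fin (∏ v ∈ C l, d v)) :=
  Equiv.ofBijective _ (hG.starMap_bijective d)

theorem IsCliqueStar.agree_iff (hG : IsCliqueStar G C S) {i j : (v : V) → Fin (d v)} {l : Fin k}
    (hs : (hG.equiv d i).1 = (hG.equiv d j).1) (hl : (hG.equiv d i).2 l = (hG.equiv d j).2 l)
    (v : V) (hv : v ∈ C l ∪ S) : i v = j v := by
  rcases Finset.mem_union.1 hv with hv | hv
  · exact congrFun ((leafEquiv d (C l)).injective hl) ⟨v, hv⟩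
  · exact congrFun hs ⟨v, hv⟩

theorem IsCliqueStar.fst_congr (hG : IsCliqueStar G C S) {i j : (v : V) → Fin (d v)}
    (h : ∀ v ∈ S, i v = j v) : (hG.equiv d i).1 = (hG.equiv d j).1 :=
  funext fun v => h v v.2

theorem IsCliqueStar.snd_congr (hG : IsCliqueStar G C S) {i j : (v : V) → Fin (d v)} {l : Fin k}
    (h : ∀ v ∈ C l, i v = j v) : (hG.equiv d i).2 l = (hG.equiv d j).2 l :=
  congrArg (leafEquiv d (C l)) (funext fun v => h v v.2)

/-- A joint state of `C l ∪ S` is the same as a center state and a state of the leaf `l`, so clique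
parameters are functions of these two. -/
theorem IsCliqueStar.exists_graphicalParam_iff (hG : IsCliqueStar G C S) (hd : ∀ v, 0 < d v)
    (P : ((v : V) → Fin (d v)) → ℂ) :
    (∃ θ, ∀ i, P i = graphicalParam G d θ i) ↔
      ∃ ψ : (l : Fin k) → ((v : S) → Fin (d v)) → Fin (∏ v ∈ C l, d v) → ℂ,
        ∀ i, P i = ∏ l, ψ l (hG.equiv d i).1 ((hG.equiv d i).2 l) := by
  classical
  have hprod : ∀ θ i, graphicalParam G d θ i = ∏ l, θ (C l ∪ S) (fun v => i v) := fun θ i => by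
    rw [graphicalParam, hG.maximalCliques_eq, Finset.prod_image fun _ _ _ _ h => hG.injective h]
  -- An arbitrary filling of the other leaves, which the parameter of `C l ∪ S` does not see.
  let t₀ : (l : Fin k) → Fin (∏ v ∈ C l, d v) := fun l => ⟨0, Finset.prod_pos fun v _ => hd v⟩
  constructor
  · rintro ⟨θ, h⟩
    refine ⟨fun l s a => θ (C l ∪ S) fun v => (hG.equiv d).symm (s, Function.update t₀ l a) v,
      fun i => ?_⟩
    rw [h, hprod]
    refine Finset.prod_congr rfl fun l _ => congrArg _ (funext fun v => ?_)
    exact hG.agree_iff (by simp) (l := l) (by simp) v v.2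
  · rintro ⟨ψ, h⟩
    let ext : (K : Finset V) → ((v : K) → Fin (d v)) → (v : V) → Fin (d v) :=
      fun K x v => if hv : v ∈ K then x ⟨v, hv⟩ else ⟨0, hd v⟩
    -- The leaf is recovered from the clique by injectivity of `l ↦ C l ∪ S`.
    refine ⟨fun K x => if hK : ∃ l, C l ∪ S = K then
      ψ hK.choose (hG.equiv d (ext K x)).1 ((hG.equiv d (ext K x)).2 hK.choose) else 0,
      fun i => ?_⟩
    rw [h, hprod]
    refine Finset.prod_congr rfl fun l _ => ?_
    have hK : ∃ l', C l' ∪ S = C l ∪ S := ⟨l, rfl⟩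
    rw [dif_pos hK, hG.injective hK.choose_spec]
    rw [hG.fst_congr (i := ext (C l ∪ S) fun v => i v) (j := i) fun v hv => by simp [ext, hv],
      hG.snd_congr (i := ext (C l ∪ S) fun v => i v) (j := i) fun v hv => by simp [ext, hv]]

/-- For a fixed center state the parametrization is a rank-one tensor in the leaf states. After
normalization its complex factors can be replaced by probability vectors, by
`mem_independenceModel_of_complex`. -/
theorem IsCliqueStar.graphicalModel_eq (hG : IsCliqueStar G C S) (hd : ∀ v, 0 < d v) :
    graphicalModel G d =
      fiberedModel (hG.equiv d) (independenceModel fun l => ∏ v ∈ C l, d v) := by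
  classical
  have hT : Nonempty ((l : Fin k) → Fin (∏ v ∈ C l, d v)) :=
    ⟨fun l => ⟨0, Finset.prod_pos fun v _ => hd v⟩⟩
  set e := hG.equiv d with he
  ext p
  rw [graphicalModel, Set.mem_ofPred_eq, hG.exists_graphicalParam_iff hd]
  constructor
  · rintro ⟨hp, ψ, h⟩
    have hpos : ∀ s, 0 < ∑ t, p (e.symm (s, t)) := fun s =>
      Finset.sum_pos (fun t _ => hp.1 _) Finset.univ_nonempty
    refine ⟨fun s => ∑ t, p (e.symm (s, t)), ⟨hpos, by rw [← sum_equiv_prod e]; exact hp.2⟩,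
      fun s t => p (e.symm (s, t)) / ∑ t, p (e.symm (s, t)), fun s => ?_, fun i => ?_⟩
    -- The normalizing constant must enter the product exactly once, so it is attached to one chosen
    -- leaf.
    · let l₀ : Fin k := ⟨0, hG.pos⟩
      refine mem_independenceModel_of_complex ⟨fun t => div_pos (hp.1 _) (hpos s), ?_⟩
        (ψ := fun l a => (if l = l₀ then ((∑ t, p (e.symm (s, t)) : ℝ) : ℂ)⁻¹ else 1) * ψ l s a)
        fun t => ?_
      · rw [← Finset.sum_div, div_self (hpos s).ne']
      · rw [Finset.prod_mul_distrib, Finset.prod_ite_eq' Finset.univ l₀,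
          if_pos (Finset.mem_univ _), Complex.ofReal_div, h, ← he, div_eq_inv_mul]
        simp
    · beta_reduce
      rw [Prod.mk.eta, Equiv.symm_apply_apply, mul_div_cancel₀ _ (hpos _).ne']
  · intro hp
    refine ⟨fiberedModel_subset_openSimplex independenceModel_subset_openSimplex hp, ?_⟩
    obtain ⟨l, hl, x, hx, hp⟩ := hp
    choose hx q hq hxq using hx
    let l₀ : Fin k := ⟨0, hG.pos⟩
    refine ⟨fun l' s a => (if l' = l₀ then (l s : ℂ) else 1) * q s l' a, fun i => ?_⟩
    rw [hp, hxq, Finset.prod_mul_distrib, Finset.prod_ite_eq' Finset.univ l₀,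
      if_pos (Finset.mem_univ _)]
    push_cast
    rfl

end CliqueStar

/-! ### The ML degree of mixtures of clique stars -/

theorem theorem5p2 {V : Type*} [Fintype V] [DecidableEq V] (G : SimpleGraph V)
    (d : V → ℕ) (hd : ∀ v, 0 < d v) {k : ℕ} (C : Fin k → Finset V) (S : Finset V)
    (hG : IsCliqueStar G C S) (r : ℕ) (hr : 1 ≤ r) (m : ℕ) :
    IsMLDegree (mixture r (graphicalModel G d)) m ↔
      ∃ N : ℕ, IsMLDegree (mixture r (independenceModel fun l => ∏ v ∈ C l, d v)) N ∧
        m = N ^ ∏ v ∈ S, d v := by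
  have hT : Nonempty ((l : Fin k) → Fin (∏ v ∈ C l, d v)) :=
    ⟨fun l => ⟨0, Finset.prod_pos fun v _ => hd v⟩⟩
  have hB : Nonempty ((v : S) → Fin (d v)) := ⟨fun v => ⟨0, hd v⟩⟩
  have hcard : Fintype.card ((v : S) → Fin (d v)) = ∏ v ∈ S, d v := by
    simp [Finset.prod_attach S d]
  rw [hG.graphicalModel_eq hd, mixture_fiberedModel _ hr, isMLDegree_fiberedModel_iff
    (mixture_subset_openSimplex independenceModel_subset_openSimplex hr), hcard]
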